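/- Let $d\ge 2$ be an even integer and let $R=\bigoplus_{n\ge 0}R^n$ be a commutative Noetherian graded ring that is generated over $R^0$ by $R^d$, i.e. $R=R^0[R^d]$. Assume that $R^0$ either contains an infinite field or is local with infinite residue field. Let $\mathsf T$ be an $R$-linear triangulated category with shift $\Sigma$: there is a homomorphism of graded rings from $R$ to the graded center of $\mathsf T$, whose degree $n$ component consists of the natural transformations $\eta:\mathrm{id}_{\mathsf T}\to\Sigma^n$ with $\eta\Sigma=(-1)^n\Sigma\eta$. Thus for objects $X,Y$ the group $\mathrm{Hom}^*_{\mathsf T}(X,Y)=\bigoplus_{n\in\mathbb Z}\mathrm{Hom}_{\mathsf T}(X,\Sigma^nY)$ is a graded $R$-module. Put $\lambda^n(X,Y)=\ell_{R^0}(\mathrm{Hom}_{\mathsf T}(X,\Sigma^nY))$. Write $\mathrm{Hom}^*_{\mathsf T}(X,Y)\in\mathsf{noeth}^{\mathsf{fl}}(R)$ if $\lambda^n(X,Y)<\infty$ for all $n\in\mathbb Z$ and the $R$-module $\bigoplus_{n\ge n_0}\mathrm{Hom}_{\mathsf T}(X,\Sigma^nY)$ is Noetherian for some $n_0\in\mathbb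 Z$. For such a pair $(X,Y)$ there are unique polynomials $g_0,\dots,g_{d-1}\in\mathbb Q[t]$ with $g_i(n)=\lambda^{dn+i}(X,Y)$ for all $n\gg0$; the complexity of the pair is $\mathrm{cx}(X,Y)=1+\max_i\deg g_i$, where the zero polynomial has degree $-1$. Let $h(X,Y)(n)=\sum_{i=0}^{d-1}(-1)^{n+i}\lambda^{n+i}(X,Y)$ for $n\in\mathbb Z$, and for $f:\mathbb Z\to\mathbb Z$ let $\Delta f(n)=f(n+d)-f(n)$. For an integer $s\ge\mathrm{cx}(X,Y)$, the $s$-multiplicity $e^s(X,Y)$ is defined as follows: if $s\ge1$, it is the constant value of $\Delta^{s-1}h(X,Y)(n)$ for all $n\gg0$; if $s=0$ (so that $\mathrm{cx}(X,Y)=0$) and $\lambda^n(X,Y)=0$ for $n\ll0$, it is $e^0(X,Y)=\sum_{n\in\mathbb Z}(-1)^n\lambda^n(X,Y)$. **Theorem.** Let $X$ be an object of $\mathsf T$ and let $Y_1\to Y_2\to Y_3\to\Sigma Y_1$ be a distinguished triangle in $\mathsf T$ with $\mathrm{Hom}^*_{\mathsf T}(X,Y_i)\in\mathsf{noeth}^{\mathsf{fl}}(R)$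 and $\mathrm{cx}(X,Y_i)\le s$ for $i=1,2,3$. Then $$e^s(X,Y_2)=e^s(X,Y_1)+e^s(X,Y_3)$$ holds if $s\ge1$, or if $s=0$ and $\lambda^n(X,Y_j)=0$ for $j=1,2,3$ and $n\ll0$. -/

import Mathlib

open CategoryTheory CategoryTheory.Limits Filter
open scoped DirectSum

universe v u w

noncomputable section

/-! ### The graded center of a triangulated category -/

section GradedCenter

variable (C : Type u) [Category.{v} C] [HasShift C ℤ] [Preadditive C]
  [∀ n : ℤ, (shiftFunctor C n).Additive]

/-- The degree `n` component of the graded center: the natural transformations `η : id ⟶ Σⁿ`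
with `η Σ = (-1)ⁿ Σ η` (the canonical isomorphism `Σⁿ Σ ≅ Σ Σⁿ` is written out). -/
def gradedCenter (n : ℤ) : AddSubgroup (𝟭 C ⟶ shiftFunctor C n) where
  carrier := {η | ∀ Y : C,
    η.app (Y⟦(1 : ℤ)⟧) ≫ (shiftFunctorComm C (1 : ℤ) n).hom.app Y =
      n.negOnePow • (η.app Y)⟦(1 : ℤ)⟧'}
  add_mem' := by
    intro a b ha hb Y
    have h1 := ha Y
    have h2 := hb Y
    simp only [NatTrans.app_add, Preadditive.add_comp, Functor.map_add, smul_add]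
    rw [h1, h2]
  zero_mem' := by
    intro Y
    simp
  neg_mem' := by
    intro a ha Y
    have h1 := ha Y
    simp only [NatTrans.app_neg, Preadditive.neg_comp, Functor.map_neg, smul_neg]
    rw [h1]

/-- The identity element of the graded center, `id ⟶ Σ⁰`. -/
def gradedCenterOne (n : ℤ) (hn : n = 0) : gradedCenter C n :=
  ⟨(shiftFunctorZero' C n hn).inv, by
    subst hn
    intro Y
    have h : (shiftFunctorZero' C (0 : ℤ) rfl) = shiftFunctorZero C ℤ := by
      ext
      simp [shiftFunctorZero']
    rw [h, shiftFunctorZero_inv_app_shift, Category.assoc, Iso.inv_hom_id_app, Int.negOnePow_zero,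
      one_smul]
    exact Category.comp_id _⟩

variable {C}

/-- The product `η ζ` in the graded center of `η` (degree `m`) and `ζ` (degree `n`): the composite
`id ⟶ Σⁿ ⟶ Σᵐ Σⁿ ≅ Σᵖ`, where `p = n + m`. -/
def gradedCenterMul {m n : ℤ} (η : gradedCenter C m) (ζ : gradedCenter C n) (p : ℤ)
    (h : n + m = p) : gradedCenter C p :=
  ⟨{ app := fun Y => ζ.1.app Y ≫ η.1.app (Y⟦n⟧) ≫ (shiftFunctorAdd' C n m p h).inv.app Y
     naturality := by
      intro Y Z f
      have h1 := ζ.1.naturality f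
      have h2 := η.1.naturality (f⟦n⟧')
      have h3 := (shiftFunctorAdd' C n m p h).inv.naturality f
      simp only [Functor.id_map, Functor.id_obj, Functor.comp_map] at h1 h2 h3 ⊢
      rw [← Category.assoc, h1, Category.assoc, ← Category.assoc _ _ ((shiftFunctorAdd' C n m p h).inv.app Z), h2]
      simp only [Category.assoc]
      rw [h3] }, by
    subst h
    intro Y
    have h1 := ζ.2 Y
    have h2 := η.2 (Y⟦n⟧)
    have h3 := η.1.naturality ((shiftFunctorComm C (1 : ℤ) n).hom.app Y)
    have h4 := shiftFunctorComm_hom_app_comp_shift_shiftFunctorAdd_hom_app (C := C) (1 : ℤ) n m Y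
    have h5 : (shiftFunctorAdd C n m).inv.app (Y⟦(1 : ℤ)⟧) ≫
        (shiftFunctorComm C (1 : ℤ) (n + m)).hom.app Y =
        ((shiftFunctorComm C (1 : ℤ) n).hom.app Y)⟦m⟧' ≫
          (shiftFunctorComm C (1 : ℤ) m).hom.app (Y⟦n⟧) ≫
          ((shiftFunctorAdd C n m).inv.app Y)⟦(1 : ℤ)⟧' := by
      rw [← cancel_mono (((shiftFunctorAdd C n m).hom.app Y)⟦(1 : ℤ)⟧'), Category.assoc, h4,
        Iso.inv_hom_id_app_assoc]
      simp only [Category.assoc, ← Functor.map_comp, Iso.inv_hom_id_app]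
      simp
    simp only [Functor.id_map, Functor.id_obj, Functor.comp_obj] at h1 h2 h3 h5 ⊢
    rw [shiftFunctorAdd'_eq_shiftFunctorAdd, Category.assoc, Category.assoc, h5,
      ← reassoc_of% h3, reassoc_of% h1, reassoc_of% h2]
    simp only [Functor.map_comp, Int.negOnePow_add, Preadditive.comp_zsmul, Preadditive.zsmul_comp,
      Units.smul_def, Units.val_mul, smul_smul, mul_comm]⟩

end GradedCenter

/-! ### `R`-linear structures and the graded `R`-module `Hom*(X, Y)` -/

section CentralAction

variable {R : Type w} [CommRing R] (𝒜 : ℕ → AddSubgroup R) [GradedRing 𝒜]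
  (C : Type u) [Category.{v} C] [HasShift C ℤ] [Preadditive C]
  [∀ n : ℤ, (shiftFunctor C n).Additive]

/-- A central action of the graded ring `R = ⨁ₙ 𝒜 n` on `C`: a homomorphism of graded rings from
`R` to the graded center of `C`, given by its homogeneous components. -/
structure CentralAction where
  toHom (n : ℕ) : 𝒜 n →+ gradedCenter C (n : ℤ)
  map_one : toHom 0 ⟨1, SetLike.GradedOne.one_mem⟩ = gradedCenterOne C ((0 : ℕ) : ℤ) rfl
  map_mul : ∀ {m n : ℕ} (a : 𝒜 m) (b : 𝒜 n),
    toHom (m + n) ⟨a.1 * b.1, SetLike.mul_mem_graded a.2 b.2⟩ =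
      gradedCenterMul (toHom m a) (toHom n b) ((m + n : ℕ) : ℤ) (by push_cast; ring)

variable {𝒜 C}

namespace CentralAction

variable (φ : CentralAction 𝒜 C) (X Y : C)

/-- The degree `n` component `Hom(X, Σⁿ Y)` of `Hom*(X, Y)`. -/
@[nolint unusedArguments]
def HomDeg (_φ : CentralAction 𝒜 C) (X Y : C) (n : ℤ) : Type v := X ⟶ Y⟦n⟧

instance (n : ℤ) : AddCommGroup (φ.HomDeg X Y n) := inferInstanceAs (AddCommGroup (X ⟶ Y⟦n⟧))

/-- The graded abelian group `Hom*(X, Y) = ⨁ₙ Hom(X, Σⁿ Y)`. -/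
def HomStar : Type v := ⨁ n : ℤ, φ.HomDeg X Y n

instance : AddCommGroup (φ.HomStar X Y) :=
  inferInstanceAs (AddCommGroup (⨁ n : ℤ, φ.HomDeg X Y n))

variable {X Y}

/-- The action of a homogeneous element `a` of degree `m` on `f : X ⟶ Σⁿ Y`, namely the composite
of `f` with `φ(a) : Σⁿ Y ⟶ Σᵐ Σⁿ Y ≅ Σᵖ Y`, where `p = n + m`. -/
def actMor {m : ℕ} (n p : ℤ) (h : n + m = p) (a : 𝒜 m) (f : X ⟶ Y⟦n⟧) : X ⟶ Y⟦p⟧ :=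
  f ≫ (φ.toHom m a).1.app (Y⟦n⟧) ≫ (shiftFunctorAdd' C n m p h).inv.app Y

lemma actMor_add {m : ℕ} (n p : ℤ) (h : n + m = p) (a b : 𝒜 m) (f : X ⟶ Y⟦n⟧) :
    φ.actMor n p h (a + b) f = φ.actMor n p h a f + φ.actMor n p h b f := by
  simp only [actMor]
  rw [_root_.map_add, AddSubgroup.coe_add, NatTrans.app_add, Preadditive.add_comp,
    Preadditive.comp_add]

lemma actMor_one (n : ℤ) (f : X ⟶ Y⟦n⟧) :
    φ.actMor (m := 0) n n (by simp) ⟨1, SetLike.GradedOne.one_mem⟩ f = f := by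
  have h : (shiftFunctorZero' C (0 : ℤ) rfl) = shiftFunctorZero C ℤ := by
    ext
    simp [shiftFunctorZero']
  simp only [actMor]
  rw [φ.map_one]
  change f ≫ (shiftFunctorZero' C (0 : ℤ) rfl).inv.app (Y⟦n⟧) ≫
    (shiftFunctorAdd' C n (0 : ℤ) n (add_zero n)).inv.app Y = f
  rw [h, shiftFunctorAdd'_add_zero_inv_app, Iso.inv_hom_id_app]
  exact Category.comp_id _

lemma actMor_mul {k m : ℕ} (a : 𝒜 k) (b : 𝒜 m) (n p q : ℤ) (h₁ : n + m = p) (h₂ : p + k = q)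
    (f : X ⟶ Y⟦n⟧) :
    φ.actMor n q (by push_cast; omega) ⟨a.1 * b.1, SetLike.mul_mem_graded a.2 b.2⟩ f =
      φ.actMor p q h₂ a (φ.actMor n p h₁ b f) := by
  have h3 := (φ.toHom k a).1.naturality ((shiftFunctorAdd' C n m p h₁).inv.app Y)
  have h4 := shiftFunctorAdd'_assoc_inv_app (C := C) n (m : ℤ) k p ((k + m : ℕ) : ℤ) q h₁
    (by push_cast; ring) (by omega) Y
  simp only [Functor.id_map, Functor.comp_obj] at h3 h4
  simp only [actMor]
  rw [φ.map_mul]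
  simp only [gradedCenterMul, Category.assoc]
  rw [reassoc_of% h3, h4]

/-- `actMor` as a biadditive map. -/
def act {m : ℕ} (n p : ℤ) (h : n + m = p) :
    𝒜 m →+ φ.HomDeg X Y n →+ φ.HomDeg X Y p :=
  AddMonoidHom.mk' (fun a => AddMonoidHom.mk' (φ.actMor n p h a)
      (fun f g => Preadditive.add_comp _ _ _ f g _))
    (fun a b => AddMonoidHom.ext fun f => φ.actMor_add n p h a b f)

lemma act_one (n : ℤ) (f : φ.HomDeg X Y n) :
    φ.act (m := 0) n n (by simp) ⟨1, SetLike.GradedOne.one_mem⟩ f = f :=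
  φ.actMor_one n f

lemma act_mul {k m : ℕ} (a : 𝒜 k) (b : 𝒜 m) (n p q : ℤ) (h₁ : n + m = p) (h₂ : p + k = q)
    (f : φ.HomDeg X Y n) :
    φ.act n q (by push_cast; omega) ⟨a.1 * b.1, SetLike.mul_mem_graded a.2 b.2⟩ f =
      φ.act p q h₂ a (φ.act n p h₁ b f) :=
  φ.actMor_mul a b n p q h₁ h₂ f

/-- The element of `Hom*(X, Y)` given by a morphism `X ⟶ Σⁿ Y`. -/
def ofDeg (n : ℤ) : φ.HomDeg X Y n →+ φ.HomStar X Y :=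
  DirectSum.of (fun n => φ.HomDeg X Y n) n

/-- The degree `n` component of an element of `Hom*(X, Y)`. -/
def component (n : ℤ) : φ.HomStar X Y →+ φ.HomDeg X Y n :=
  DFinsupp.evalAddMonoidHom n

lemma homStar_hom_ext {A : Type*} [AddCommGroup A] {g h : φ.HomStar X Y →+ A}
    (H : ∀ n f, g (φ.ofDeg n f) = h (φ.ofDeg n f)) : g = h :=
  DirectSum.addHom_ext H

lemma homStar_end_ext {g h : AddMonoid.End (φ.HomStar X Y)}
    (H : ∀ n f, g (φ.ofDeg n f) = h (φ.ofDeg n f)) : g = h :=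
  φ.homStar_hom_ext H

/-- The additive map out of `Hom*(X, Y)` with given restrictions to the components. -/
def lift {A : Type*} [AddCommGroup A] (g : ∀ n, φ.HomDeg X Y n →+ A) : φ.HomStar X Y →+ A :=
  DirectSum.toAddMonoid g

lemma lift_ofDeg {A : Type*} [AddCommGroup A] (g : ∀ n, φ.HomDeg X Y n →+ A) (n : ℤ)
    (f : φ.HomDeg X Y n) : φ.lift g (φ.ofDeg n f) = g n f :=
  DirectSum.toAddMonoid_of _ _ _

/-- The additive endomorphism of `Hom*(X, Y)` given by a homogeneous element of degree `m`. -/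
def actEnd {m : ℕ} (a : 𝒜 m) : AddMonoid.End (φ.HomStar X Y) :=
  (φ.lift fun n => (φ.ofDeg (n + m)).comp (φ.act n (n + m) rfl a) :
    φ.HomStar X Y →+ φ.HomStar X Y)

lemma actEnd_ofDeg {m : ℕ} (a : 𝒜 m) (n : ℤ) (f : φ.HomDeg X Y n) :
    φ.actEnd a (φ.ofDeg n f) = φ.ofDeg (n + m) (φ.act n (n + m) rfl a f) :=
  φ.lift_ofDeg _ _ _

/-- `actEnd` as an additive map. -/
def actHom (m : ℕ) : 𝒜 m →+ AddMonoid.End (φ.HomStar X Y) :=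
  AddMonoidHom.mk' φ.actEnd (fun a b => φ.homStar_end_ext fun n f => by
    change _ = φ.actEnd a (φ.ofDeg n f) + φ.actEnd b (φ.ofDeg n f)
    simp only [actEnd_ofDeg, _root_.map_add, AddMonoidHom.add_apply])

lemma actHom_ofDeg {m : ℕ} (a : 𝒜 m) (n p : ℤ) (h : n + m = p) (f : φ.HomDeg X Y n) :
    φ.actHom m a (φ.ofDeg n f) = φ.ofDeg p (φ.act n p h a f) := by
  subst h
  exact φ.actEnd_ofDeg _ _ _

variable (X Y)

lemma actHom_one :
    φ.actHom (X := X) (Y := Y) 0 ⟨1, SetLike.GradedOne.one_mem⟩ = 1 :=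
  φ.homStar_end_ext fun n f => by
    rw [φ.actHom_ofDeg _ n n (by simp)]
    exact congrArg _ (φ.act_one n f)

lemma actHom_mul {k m : ℕ} (a : 𝒜 k) (b : 𝒜 m) :
    φ.actHom (X := X) (Y := Y) (k + m) ⟨a.1 * b.1, SetLike.mul_mem_graded a.2 b.2⟩ =
      φ.actHom k a * φ.actHom m b :=
  φ.homStar_end_ext fun n f => by
    change φ.actHom (k + m) _ (φ.ofDeg n f) = φ.actHom k a (φ.actHom m b (φ.ofDeg n f))
    rw [φ.actHom_ofDeg b n (n + m) rfl, φ.actHom_ofDeg a (n + m) (n + m + k) rfl,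
      φ.actHom_ofDeg _ n (n + m + k) (by push_cast; ring)]
    exact congrArg _ (φ.act_mul a b n _ _ rfl rfl f)

/-- The action of `R` on `Hom*(X, Y)`, as a ring homomorphism to the additive endomorphisms. -/
def actRingHom : R →+* AddMonoid.End (φ.HomStar X Y) :=
  (DirectSum.toSemiring (fun m => φ.actHom (X := X) (Y := Y) m) (φ.actHom_one X Y)
    (fun a b => φ.actHom_mul X Y a b)).comp
    (DirectSum.decomposeRingEquiv 𝒜).toRingHom

lemma actRingHom_coe {m : ℕ} (a : 𝒜 m) : φ.actRingHom X Y a.1 = φ.actHom m a := by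
  have h2 : DirectSum.decomposeRingEquiv 𝒜 a.1 = DirectSum.of (fun i => 𝒜 i) m a :=
    DirectSum.decompose_coe 𝒜 a
  simp only [actRingHom, RingHom.comp_apply, RingEquiv.toRingHom_eq_coe, RingHom.coe_coe, h2]
  exact DirectSum.toSemiring_of _ _ _ _ _

/-- `Hom*(X, Y)` as an `R`-module. -/
instance : Module R (φ.HomStar X Y) := Module.compHom _ (φ.actRingHom X Y)

lemma smul_ofDeg {m : ℕ} (a : 𝒜 m) (n p : ℤ) (h : n + m = p) (f : φ.HomDeg X Y n) :
    a.1 • φ.ofDeg n f = φ.ofDeg p (φ.act n p h a f) := by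
  change φ.actRingHom X Y a.1 (φ.ofDeg n f) = _
  rw [← φ.actHom_ofDeg a n p h f, φ.actRingHom_coe]

lemma component_smul {m : ℕ} (a : 𝒜 m) (n p : ℤ) (h : n + m = p) (x : φ.HomStar X Y) :
    φ.component p (a.1 • x) = φ.act n p h a (φ.component n x) := by
  suffices H : (φ.component p).comp (DistribSMul.toAddMonoidHom (φ.HomStar X Y) a.1) =
      (φ.act n p h a).comp (φ.component n) from DFunLike.congr_fun H x
  refine φ.homStar_hom_ext fun k f => ?_
  change φ.component p (a.1 • φ.ofDeg k f) = φ.act n p h a (φ.component n (φ.ofDeg k f))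
  rw [φ.smul_ofDeg X Y a k (k + m) rfl]
  by_cases hk : k = n
  · subst hk
    subst h
    refine (DirectSum.of_eq_same _ _).trans (congrArg _ (DirectSum.of_eq_same _ _).symm)
  · refine (DirectSum.of_eq_of_ne _ _ _ (by omega)).trans ?_
    refine ((congrArg _ (DirectSum.of_eq_of_ne _ _ _ (Ne.symm hk))).trans
      (_root_.map_zero _)).symm

/-- `Hom(X, Σⁿ Y)` as an `R⁰`-module. -/
instance (n : ℤ) : Module (𝒜 0) (φ.HomDeg X Y n) where
  smul a f := φ.act n n (by simp) a f
  one_smul f := φ.act_one n f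
  mul_smul a b f := φ.act_mul a b n n n (by simp) (by simp) f
  smul_zero a := _root_.map_zero _
  smul_add a := _root_.map_add _
  add_smul a b f := by
    change φ.act n n _ (a + b) f = _
    rw [_root_.map_add]
    rfl
  zero_smul f := by
    change φ.act n n _ 0 f = _
    rw [_root_.map_zero]
    rfl

/-- The `R`-submodule `Hom^{≥ n₀}(X, Y) = ⨁_{n ≥ n₀} Hom(X, Σⁿ Y)` of `Hom*(X, Y)`. -/
def homGE (n₀ : ℤ) : Submodule R (φ.HomStar X Y) where
  carrier := {x | ∀ n < n₀, φ.component n x = 0}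
  add_mem' := by
    intro x y hx hy n hn
    rw [_root_.map_add, hx n hn, hy n hn, add_zero]
  zero_mem' := fun n _ => _root_.map_zero _
  smul_mem' := by
    intro r x hx
    induction r using DirectSum.Decomposition.inductionOn 𝒜 with
    | zero =>
      intro n _
      rw [zero_smul, _root_.map_zero]
    | @homogeneous m a =>
      intro n hn
      rw [φ.component_smul X Y a (n - m) n (by omega), hx (n - m) (by omega), _root_.map_zero]
    | add a b ha hb =>
      intro n hn
      rw [add_smul, _root_.map_add, ha n hn, hb n hn, add_zero]

/-! ### Lengths, Hilbert polynomials, complexity and multiplicity -/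

/-- The length of `Hom(X, Σⁿ Y)` over `R⁰`, a natural number or `⊤`. -/
def homLength (n : ℤ) : ℕ∞ := Module.length (𝒜 0) (φ.HomDeg X Y n)

/-- `Hom*(X, Y)` is eventually Noetherian and of degreewise finite length. -/
structure IsNoethFl : Prop where
  eventually_noetherian : ∃ n₀ : ℤ, IsNoetherian R (φ.homGE X Y n₀)
  homLength_lt_top : ∀ n : ℤ, φ.homLength X Y n < ⊤

/-- `λⁿ(X, Y)`, the length of `Hom(X, Σⁿ Y)` over `R⁰` as a number (used when it is finite). -/
def lam (n : ℤ) : ℕ := (φ.homLength X Y n).toNat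

/-- The index `d` generalized Herbrand difference `h(X, Y) : ℤ → ℤ`. -/
def herbrand (d : ℕ) (n : ℤ) : ℤ :=
  ∑ i ∈ Finset.range d, ((n + i).negOnePow : ℤ) * (φ.lam X Y (n + i) : ℤ)

/-- `g` is a polynomial with `g(n) = λ^{dn+i}(X, Y)` for all `n ≫ 0`. -/
def IsHilbertPoly (d i : ℕ) (g : Polynomial ℚ) : Prop :=
  ∀ᶠ n : ℤ in atTop, g.eval (n : ℚ) = (φ.lam X Y (d * n + i) : ℚ)

open Classical in
/-- The `i`-th Hilbert polynomial of `(X, Y)`: the unique `g` with `g(n) = λ^{dn+i}(X, Y)` for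
`n ≫ 0` (and `0` if there is none, which does not happen when `Hom*(X, Y)` is eventually Noetherian
of degreewise finite length and `R` is generated over `R⁰` in degree `d`). -/
def hilbertPoly (d i : ℕ) : Polynomial ℚ :=
  if h : ∃ g, φ.IsHilbertPoly X Y d i g then h.choose else 0

open Classical in
/-- The complexity `1 + max deg gᵢ` of `(X, Y)`, the zero polynomial having degree `-1`. -/
def cx (d : ℕ) : ℕ :=
  (Finset.range d).sup fun i =>
    if φ.hilbertPoly X Y d i = 0 then 0 else 1 + (φ.hilbertPoly X Y d i).natDegree

end CentralAction

end CentralAction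

/-- The difference operator of index `d`. -/
def diffOp (d : ℕ) (f : ℤ → ℤ) (n : ℤ) : ℤ := f (n + d) - f n

open Classical in
/-- The value `f(n)` for all `n ≫ 0` (and `0` if `f` is not eventually constant). -/
def eventualValue (f : ℤ → ℤ) : ℤ :=
  if h : ∃ c : ℤ, ∀ᶠ n : ℤ in atTop, f n = c then h.choose else 0

/-- The `s`-multiplicity `e^s(X, Y)`: the eventual value of `Δ^{s-1} h(X, Y)` if `s ≥ 1`, and the
alternating sum of all `λⁿ(X, Y)` if `s = 0`. -/
def CentralAction.mult {R : Type w} [CommRing R] {𝒜 : ℕ → AddSubgroup R} [GradedRing 𝒜]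
    {C : Type u} [Category.{v} C] [HasShift C ℤ] [Preadditive C]
    [∀ n : ℤ, (shiftFunctor C n).Additive] (φ : CentralAction 𝒜 C) (X Y : C) (d : ℕ) : ℕ → ℤ
  | 0 => ∑ᶠ n : ℤ, (n.negOnePow : ℤ) * (φ.lam X Y n : ℤ)
  | s + 1 => eventualValue ((diffOp d)^[s] (φ.herbrand X Y d))

end

/-! ### Difference operators and eventually polynomial functions -/

section DiffOp

/-! Let K be the kernel of Hom*(X, Y₁) → Hom*(X, Y₂), and let k(n) be the length of its degree n
part. The long exact sequence of the triangle gives λⁿ(X, Y₁) - λⁿ(X, Y₂) + λⁿ(X, Y₃) = k(n) +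
k(n+1) (`lam_add_lam`). With the sign (-1)ⁿ the right side telescopes. Over d consecutive degrees, d
being even, it sums to -(-1)ⁿ Δk(n), so Δ^{s-1} of the defect h₁ + h₃ - h₂ is -(-1)ⁿ Δˢk(n). For s =
0 the sum over all degrees is zero.

It remains to see that Δˢk vanishes eventually (`StableFamily.diffOp_iter_len_eventually_zero`). A
Hilbert-Serre argument (`exists_diffOp_iter_len_sub_len`) shows that some Δᴺk vanishes eventually,
hence that k is eventually polynomial on each residue class modulo d. Since 0 ≤ k ≤ λ(X, Y₁), these
polynomials have degree less than s. -/

lemma diffOp_eq_fwdDiff (d : ℕ) : diffOp d = fwdDiff (d : ℤ) := rfl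

lemma diffOp_iter_add (d N : ℕ) (f g : ℤ → ℤ) :
    (diffOp d)^[N] (f + g) = (diffOp d)^[N] f + (diffOp d)^[N] g := by
  simp only [diffOp_eq_fwdDiff, fwdDiff_iter_add]

lemma diffOp_iter_zero_fun (d N : ℕ) : (diffOp d)^[N] (0 : ℤ → ℤ) = 0 :=
  Function.iterate_fixed (by ext; simp [diffOp]) N

lemma diffOp_iter_neg (d N : ℕ) (f : ℤ → ℤ) :
    (diffOp d)^[N] (-f) = -(diffOp d)^[N] f := by
  have h := diffOp_iter_add d N f (-f)
  rw [add_neg_cancel, diffOp_iter_zero_fun] at h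
  exact (neg_eq_of_add_eq_zero_right h.symm).symm

lemma diffOp_iter_sub (d N : ℕ) (f g : ℤ → ℤ) :
    (diffOp d)^[N] (f - g) = (diffOp d)^[N] f - (diffOp d)^[N] g := by
  rw [sub_eq_add_neg, diffOp_iter_add, diffOp_iter_neg, sub_eq_add_neg]

lemma tendsto_add_atTop_int (c : ℤ) : Tendsto (fun n : ℤ => n + c) atTop atTop :=
  tendsto_atTop_add_const_right _ _ tendsto_id

lemma diffOp_iter_comp_add (d N : ℕ) (f : ℤ → ℤ) (c : ℤ) :
    (diffOp d)^[N] (fun n => f (n + c)) = fun n => (diffOp d)^[N] f (n + c) := by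
  ext n
  rw [diffOp_eq_fwdDiff, fwdDiff_iter_comp_add]

lemma diffOp_iter_congr (d N : ℕ) {f g : ℤ → ℤ} (h : f =ᶠ[atTop] g) :
    (diffOp d)^[N] f =ᶠ[atTop] (diffOp d)^[N] g := by
  induction N generalizing f g with
  | zero => exact h
  | succ N ih =>
    refine ih ?_
    filter_upwards [h, (tendsto_add_atTop_int d).eventually h] with n h1 h2
    simp only [diffOp, h1, h2]

lemma diffOp_iter_eventually_zero_mono (d : ℕ) {N M : ℕ} (hNM : N ≤ M) {f : ℤ → ℤ}
    (h : (diffOp d)^[N] f =ᶠ[atTop] 0) : (diffOp d)^[M] f =ᶠ[atTop] 0 := by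
  obtain ⟨k, rfl⟩ := Nat.exists_eq_add_of_le' hNM
  rw [Function.iterate_add_apply]
  refine (diffOp_iter_congr d k h).trans ?_
  rw [diffOp_iter_zero_fun]

/-- The values along an arithmetic progression of difference `d` of a function killed by a power of
the difference operator are eventually polynomial. -/
lemma exists_polynomial_of_diffOp_iter_eventually_zero {d : ℕ} (hd : 0 < d) {f : ℤ → ℤ} {N : ℕ}
    (h : (diffOp d)^[N] f =ᶠ[atTop] 0) (i : ℕ) :
    ∃ g : Polynomial ℚ, ∀ᶠ n : ℤ in atTop, g.eval (n : ℚ) = (f (d * n + i) : ℚ) := by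
  -- A base point at which all differences of order at least N vanish, so that Newton's forward
  -- difference formula stops at order N.
  obtain ⟨n₀, hn₀⟩ : ∃ n₀ : ℤ, ∀ k, N ≤ k → (diffOp d)^[k] f (d * n₀ + i) = 0 := by
    obtain ⟨m, hm⟩ := eventually_atTop.1 h
    -- Nonnegativity together with d ≥ 1 gives d * n₀ + i ≥ n₀ ≥ m.
    refine ⟨max m 0, fun k hk => ?_⟩
    have key : ∀ (j : ℕ) (n : ℤ), m ≤ n → (diffOp d)^[j] ((diffOp d)^[N] f) n = 0 := by
      intro j
      induction j with
      | zero => exact hm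
      | succ j ih =>
        intro n hn
        rw [Function.iterate_succ_apply']
        simp only [diffOp]
        rw [ih _ hn, ih _ (by omega), sub_zero]
    obtain ⟨j, rfl⟩ := Nat.exists_eq_add_of_le' hk
    rw [Function.iterate_add_apply]
    refine key j _ ?_
    have h1 : (1 : ℤ) ≤ d := by exact_mod_cast hd
    nlinarith [le_max_left m 0, le_max_right m 0]
  refine ⟨∑ k ∈ Finset.range N, Polynomial.C
    (((diffOp d)^[k] f (d * n₀ + i) : ℚ) / (k.factorial : ℚ)) *
      ((descPochhammer ℚ k).comp (Polynomial.X - Polynomial.C (n₀ : ℚ))), ?_⟩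
  filter_upwards [eventually_ge_atTop n₀] with n hn
  obtain ⟨m, rfl⟩ : ∃ m : ℕ, n = n₀ + m := ⟨(n - n₀).toNat, by omega⟩
  have h1 := shift_eq_sum_fwdDiff_iter (d : ℤ) f m (d * n₀ + i)
  have h2 : (d : ℤ) * n₀ + i + m • (d : ℤ) = d * (n₀ + m) + i := by
    simp only [nsmul_eq_mul]; ring
  rw [h2, ← diffOp_eq_fwdDiff] at h1
  rw [h1]
  -- Both sums extend by zero to a common range: the binomial coefficients vanish for k > m, the
  -- differences for k ≥ N.
  have h3 : ∀ M, N ≤ M → m + 1 ≤ M →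
      (∑ k ∈ Finset.range (m + 1), m.choose k • (diffOp d)^[k] f (d * n₀ + i)) =
      ∑ k ∈ Finset.range N, m.choose k • (diffOp d)^[k] f (d * n₀ + i) := by
    intro M hM hM'
    trans ∑ k ∈ Finset.range M, m.choose k • (diffOp d)^[k] f (d * n₀ + i)
    · refine Finset.sum_subset (Finset.range_mono hM') fun k _ hk => ?_
      rw [Nat.choose_eq_zero_of_lt (by simpa using hk), zero_smul]
    · refine (Finset.sum_subset (Finset.range_mono hM) fun k _ hk => ?_).symm
      rw [hn₀ k (by simpa using hk), smul_zero]
  rw [h3 (max N (m + 1)) (le_max_left _ _) (le_max_right _ _), Polynomial.eval_finsetSum]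
  push_cast
  refine Finset.sum_congr rfl fun k _ => ?_
  simp only [Polynomial.eval_mul, Polynomial.eval_C, Polynomial.eval_comp, Polynomial.eval_sub,
    Polynomial.eval_X, add_sub_cancel_left, nsmul_eq_mul, Int.cast_mul, Int.cast_natCast]
  rw [descPochhammer_eval_eq_descFactorial, Nat.descFactorial_eq_factorial_mul_choose]
  have : (k.factorial : ℚ) ≠ 0 := by exact_mod_cast k.factorial_ne_zero
  push_cast
  field_simp

/-- A function is eventually killed by the `s`-th difference operator of index `d` if along each
residue class modulo `d` it is eventually given by a polynomial of degree less than `s`. -/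
lemma diffOp_iter_eventually_zero_of_polynomial {d : ℕ} (hd : 0 < d) {f : ℤ → ℤ} {s : ℕ}
    (h : ∀ i < d, ∃ g : Polynomial ℚ, g.degree < s ∧
      ∀ᶠ n : ℤ in atTop, g.eval (n : ℚ) = (f (d * n + i) : ℚ)) :
    (diffOp d)^[s] f =ᶠ[atTop] 0 := by
  have key : ∀ i < d, ∀ᶠ n : ℤ in atTop, (diffOp d)^[s] f (d * n + i) = 0 := by
    intro i hi
    obtain ⟨g, hg, hgf⟩ := h i hi
    obtain ⟨m, hm⟩ := eventually_atTop.1 hgf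
    filter_upwards [eventually_ge_atTop m] with n hn
    have h1 := fwdDiff_iter_eq_sum_shift (d : ℤ) f s (d * n + i)
    have h2 := fwdDiff_iter_eq_sum_shift (1 : ℚ) g.eval s n
    have h3 : (fwdDiff (1 : ℚ))^[s] g.eval (n : ℚ) = 0 := by
      -- The zero polynomial has `natDegree` 0, which is not less than s when s = 0.
      by_cases hg0 : g = 0
      · rw [h2]
        simp [hg0]
      · rw [Polynomial.fwdDiff_iter_eq_zero_of_degree_lt
          ((Polynomial.natDegree_lt_iff_degree_lt hg0).2 hg)]
        rfl
    rw [← diffOp_eq_fwdDiff] at h1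
    rw [h3] at h2
    have h4 : ((diffOp d)^[s] f (d * n + i) : ℚ) = 0 := by
      rw [h1, h2]
      push_cast
      refine Finset.sum_congr rfl fun k _ => ?_
      have h5 := hm (n + k) (by omega)
      have h6 : (d : ℤ) * n + i + k • (d : ℤ) = d * (n + k) + i := by
        simp only [nsmul_eq_mul]; ring
      rw [h6]
      simp only [zsmul_eq_mul, smul_eq_mul, nsmul_eq_mul, mul_one, Int.cast_mul, ← h5]
      push_cast
      rfl
    exact_mod_cast h4
  have key' : ∀ᶠ n : ℤ in atTop, ∀ i ∈ Finset.range d, (diffOp d)^[s] f (d * n + i) = 0 :=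
    (Finset.eventually_all _).2 fun i hi => key i (Finset.mem_range.1 hi)
  obtain ⟨m, hm⟩ := eventually_atTop.1 key'
  have hd' : (0 : ℤ) < d := by exact_mod_cast hd
  filter_upwards [eventually_ge_atTop (d * m)] with n hn
  have h1 := hm (n / d) ((Int.le_ediv_iff_mul_le hd').2 (by rwa [mul_comm])) (n % d).toNat
    (Finset.mem_range.2 (by have := Int.emod_lt_of_pos n hd'; have := Int.emod_nonneg n hd'.ne'; omega))
  rwa [Int.toNat_of_nonneg (Int.emod_nonneg n hd'.ne'), Int.mul_ediv_add_emod] at h1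

/-- Otherwise g₂ = o(g₁), so 0 ≤ g₁ ≤ g₂ ≤ g₁ / 2 at large integers. This makes them roots of g₁,
but a nonzero polynomial has no large roots. -/
lemma Polynomial.degree_le_of_eventually_le {g₁ g₂ : Polynomial ℚ}
    (h : ∀ᶠ n : ℤ in atTop, 0 ≤ g₁.eval (n : ℚ) ∧ g₁.eval (n : ℚ) ≤ g₂.eval (n : ℚ)) :
    g₁.degree ≤ g₂.degree := by
  by_contra! hlt
  have h0 : g₁ ≠ 0 := by
    rintro rfl
    simp at hlt
  have hcast : Tendsto (fun n : ℤ => (n : ℚ)) atTop atTop := tendsto_intCast_atTop_atTop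
  have h1 := (Polynomial.isLittleO_atTop_of_degree_lt g₂ g₁ hlt).comp_tendsto hcast
  have h2 := h1.bound (show (0 : ℝ) < 1 / 2 by norm_num)
  have h3 := hcast.eventually (Polynomial.eventually_atTop_not_isRoot g₁ h0)
  obtain ⟨n, ⟨ha, hb⟩, hc, hr⟩ := (h.and (h2.and h3)).exists
  simp only [Function.comp_apply, ← Rat.norm_cast_real, Real.norm_eq_abs] at hc
  rw [abs_of_nonneg (Rat.cast_nonneg.2 (ha.trans hb)), abs_of_nonneg (Rat.cast_nonneg.2 ha)] at hc
  have hc' : g₂.eval (n : ℚ) ≤ 1 / 2 * g₁.eval (n : ℚ) := by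
    have : ((g₂.eval (n : ℚ) : ℚ) : ℝ) ≤ ((1 / 2 * g₁.eval (n : ℚ) : ℚ) : ℝ) := by
      push_cast
      exact hc
    exact_mod_cast this
  exact hr (show g₁.eval (n : ℚ) = 0 by linarith)

/-- Domination by a function of small growth lowers the order of a difference operator killing
an eventually polynomial function. -/
lemma diffOp_iter_eventually_zero_of_le {d : ℕ} (hd : 0 < d) {k l : ℤ → ℤ} {s N : ℕ}
    (hk : ∀ n, 0 ≤ k n) (hkl : ∀ n, k n ≤ l n) (hN : (diffOp d)^[N] k =ᶠ[atTop] 0)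
    (hl : ∀ i < d, ∃ g : Polynomial ℚ, g.degree < s ∧
      ∀ᶠ n : ℤ in atTop, g.eval (n : ℚ) = (l (d * n + i) : ℚ)) :
    (diffOp d)^[s] k =ᶠ[atTop] 0 := by
  refine diffOp_iter_eventually_zero_of_polynomial hd fun i hi => ?_
  obtain ⟨g, hg⟩ := exists_polynomial_of_diffOp_iter_eventually_zero hd hN i
  obtain ⟨g', hdeg, hg'⟩ := hl i hi
  refine ⟨g, (Polynomial.degree_le_of_eventually_le ?_).trans_lt hdeg, hg⟩
  filter_upwards [hg, hg'] with n h1 h2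
  rw [h1, h2]
  exact ⟨by exact_mod_cast hk _, by exact_mod_cast hkl _⟩

lemma eventually_const_of_eventually_add_one_eq {f : ℤ → ℤ}
    (h : ∀ᶠ n : ℤ in atTop, f (n + 1) = f n) : ∃ c, ∀ᶠ n : ℤ in atTop, f n = c := by
  obtain ⟨m, hm⟩ := eventually_atTop.1 h
  refine ⟨f m, ?_⟩
  filter_upwards [eventually_ge_atTop m] with n hn
  induction n, hn using Int.leInduction with
  | base => rfl
  | succ n hn ih => rw [hm n hn, ih]

lemma eventualValue_eq {f : ℤ → ℤ} {c : ℤ} (h : ∀ᶠ n : ℤ in atTop, f n = c) :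
    eventualValue f = c := by
  have hex : ∃ c : ℤ, ∀ᶠ n : ℤ in atTop, f n = c := ⟨c, h⟩
  rw [eventualValue, dif_pos hex]
  obtain ⟨n, h1, h2⟩ := (hex.choose_spec.and h).exists
  rw [← h1, h2]

end DiffOp

/-! ### Lengths of submodules -/

lemma Module.length_ker_add_length_range {A M N : Type*} [Ring A] [AddCommGroup M] [Module A M]
    [AddCommGroup N] [Module A N] (f : M →ₗ[A] N) :
    Module.length A f.ker + Module.length A f.range = Module.length A M :=
  (Module.length_eq_add_of_exact f.ker.subtype f.rangeRestrict (Submodule.subtype_injective _)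
    f.surjective_rangeRestrict (by
      rw [LinearMap.exact_iff, LinearMap.ker_rangeRestrict, Submodule.range_subtype])).symm

/-- Rank-nullity for P × Q → N, (p, q) ↦ p + f q: in the kernel, q determines p = -f q. This
replaces the kernel-cokernel sequence of a map between quotients, so that no quotient module has to
be formed. -/
lemma Submodule.length_sup_map_add_length_inf_comap {A M N : Type*} [Ring A] [AddCommGroup M]
    [Module A M] [AddCommGroup N] [Module A N] (f : M →ₗ[A] N) (P : Submodule A N)
    (Q : Submodule A M) :
    Module.length A ↥(P ⊔ Q.map f) + Module.length A ↥(Q ⊓ P.comap f) =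
      Module.length A P + Module.length A Q := by
  let g : P × Q →ₗ[A] N := P.subtype.coprod (f ∘ₗ Q.subtype)
  have hg : g.range = P ⊔ Q.map f := by
    rw [LinearMap.range_coprod, LinearMap.range_comp, Submodule.range_subtype,
      Submodule.range_subtype]
  have e : g.ker ≃ₗ[A] ↥(Q ⊓ P.comap f) :=
    LinearEquiv.ofBijective
      ((Q.subtype ∘ₗ LinearMap.snd A P Q ∘ₗ g.ker.subtype).codRestrict _ (by
        rintro ⟨⟨p, q⟩, h⟩
        have h' : (p : N) + f q = 0 := h
        exact ⟨q.2, show f q ∈ P from (eq_neg_of_add_eq_zero_right h') ▸ P.neg_mem p.2⟩))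
      ⟨by
        rintro ⟨⟨p, q⟩, h⟩ ⟨⟨p', q'⟩, h'⟩ hq
        have h₁ : (p : N) + f q = 0 := h
        have h₂ : (p' : N) + f q' = 0 := h'
        have h₃ : (q : M) = q' := congrArg (fun z : ↥(Q ⊓ P.comap f) => (z : M)) hq
        have h₄ : (p : N) = p' := by
          rw [eq_neg_of_add_eq_zero_left h₁, eq_neg_of_add_eq_zero_left h₂, h₃]
        simp only [Subtype.mk.injEq, Prod.mk.injEq]
        exact ⟨Subtype.ext h₄, Subtype.ext h₃⟩, by
        rintro ⟨q, hq, hp⟩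
        exact ⟨⟨(⟨-f q, P.neg_mem hp⟩, ⟨q, hq⟩), neg_add_cancel (f q)⟩, rfl⟩⟩
  rw [← hg, ← e.length_eq, ← Module.length_prod A P Q, ← Module.length_ker_add_length_range g, add_comm]

/-! ### Graded rings generated in one degree -/

/-- The sums of an element of degree 0 and an element of the ideal generated by degree d form a
subring, hence all of R. That ideal is homogeneous, so it contains the degree m component of a - c,
which is a because m ≠ 0. -/
lemma GradedRing.mem_span_of_closure_eq_top {R : Type*} [CommRing R] (𝒜 : ℕ → AddSubgroup R)
    [GradedRing 𝒜] {d : ℕ} (hgen : Subring.closure ((𝒜 0 : Set R) ∪ (𝒜 d : Set R)) = ⊤)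
    {m : ℕ} (hm : 0 < m) {a : R} (ha : a ∈ 𝒜 m) : a ∈ Ideal.span (𝒜 d : Set R) := by
  have key : ∀ r ∈ Subring.closure ((𝒜 0 : Set R) ∪ (𝒜 d : Set R)),
      ∃ c ∈ 𝒜 0, r - c ∈ Ideal.span (𝒜 d : Set R) := by
    intro r hr
    induction hr using Subring.closure_induction with
    | mem x hx =>
      rcases hx with hx | hx
      · exact ⟨x, hx, by simp⟩
      · exact ⟨0, zero_mem _, by simpa using Ideal.subset_span hx⟩
    | zero => exact ⟨0, zero_mem _, by simp⟩
    | one => exact ⟨1, SetLike.GradedOne.one_mem, by simp⟩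
    | add x y _ _ hx hy =>
      obtain ⟨b, hb, hb'⟩ := hx
      obtain ⟨c, hc, hc'⟩ := hy
      exact ⟨b + c, add_mem hb hc, by simpa only [add_sub_add_comm] using add_mem hb' hc'⟩
    | neg x _ hx =>
      obtain ⟨b, hb, hb'⟩ := hx
      exact ⟨-b, neg_mem hb, by simpa only [neg_sub_neg, neg_sub] using neg_mem hb'⟩
    | mul x y _ _ hx hy =>
      obtain ⟨b, hb, hb'⟩ := hx
      obtain ⟨c, hc, hc'⟩ := hy
      refine ⟨b * c, by simpa using SetLike.mul_mem_graded hb hc, ?_⟩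
      rw [show x * y - b * c = y * (x - b) + b * (y - c) by ring]
      exact add_mem (Ideal.mul_mem_left _ _ hb') (Ideal.mul_mem_left _ _ hc')
  obtain ⟨c, hc, hac⟩ := key a (hgen ▸ Subring.mem_top a)
  have h := Ideal.homogeneous_span 𝒜 (𝒜 d : Set R) (fun x hx => ⟨d, hx⟩) m hac
  rw [DirectSum.decompose_sub, DirectSum.sub_apply, AddSubgroup.coe_sub,
    DirectSum.decompose_of_mem_same 𝒜 ha, DirectSum.decompose_of_mem_ne 𝒜 hc hm.ne, sub_zero] at h
  exact h

lemma GradedRing.exists_finset_span_eq {R : Type*} [CommRing R] [IsNoetherianRing R]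
    (𝒜 : ℕ → AddSubgroup R) (d : ℕ) :
    ∃ G : Finset R, (G : Set R) ⊆ 𝒜 d ∧ Ideal.span (𝒜 d : Set R) = Ideal.span (G : Set R) := by
  obtain ⟨G, hG, h⟩ := (Submodule.fg_span_iff_fg_span_finset_subset (𝒜 d : Set R)).1
    (IsNoetherian.noetherian (Ideal.span (𝒜 d : Set R)))
  exact ⟨G, hG, h⟩

/-! ### Families of submodules stable under the action -/

namespace CentralAction

variable {R : Type w} [CommRing R] {𝒜 : ℕ → AddSubgroup R} [GradedRing 𝒜]
  {C : Type u} [Category.{v} C] [HasShift C ℤ] [Preadditive C]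
  [∀ n : ℤ, (shiftFunctor C n).Additive] (φ : CentralAction 𝒜 C) {X Y : C}

lemma component_ofDeg (n : ℤ) (f : φ.HomDeg X Y n) : φ.component n (φ.ofDeg n f) = f :=
  DirectSum.of_eq_same _ _

lemma component_ofDeg_of_ne {n k : ℤ} (h : n ≠ k) (f : φ.HomDeg X Y n) :
    φ.component k (φ.ofDeg n f) = 0 :=
  DirectSum.of_eq_of_ne _ _ _ h.symm

lemma ofDeg_injective (n : ℤ) : Function.Injective (φ.ofDeg (X := X) (Y := Y) n) :=
  Function.LeftInverse.injective (φ.component_ofDeg n)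

/-- Inherited from the commutativity of R, through the embedding of each component in the R-module
Hom*(X, Y). -/
lemma act_comm {k m : ℕ} (a : 𝒜 k) (b : 𝒜 m) {n p p' q : ℤ} (h₁ : n + m = p) (h₂ : p + k = q)
    (h₃ : n + k = p') (h₄ : p' + m = q) (f : φ.HomDeg X Y n) :
    φ.act p q h₂ a (φ.act n p h₁ b f) = φ.act p' q h₄ b (φ.act n p' h₃ a f) := by
  apply φ.ofDeg_injective
  rw [← φ.smul_ofDeg, ← φ.smul_ofDeg, ← φ.smul_ofDeg, ← φ.smul_ofDeg, smul_comm]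

/-- The action of a homogeneous element as an `R⁰`-linear map. -/
def actLinear {m : ℕ} (a : 𝒜 m) (n p : ℤ) (h : n + m = p) :
    φ.HomDeg X Y n →ₗ[𝒜 0] φ.HomDeg X Y p where
  toFun := φ.act n p h a
  map_add' := _root_.map_add _
  map_smul' c f := φ.act_comm a c _ h h _ f

variable (X Y) in
/-- A family of `R⁰`-submodules of the components of `Hom*(X, Y)`, stable under the action of the
homogeneous elements of `R`. -/
structure StableFamily where
  deg (n : ℤ) : Submodule (𝒜 0) (φ.HomDeg X Y n)
  act_mem : ∀ {m : ℕ} {n p : ℤ} (h : n + m = p) (a : 𝒜 m) {f : φ.HomDeg X Y n},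
    f ∈ deg n → φ.act n p h a f ∈ deg p

namespace StableFamily

variable {φ} (P Q : φ.StableFamily X Y)

/-- The graded `R`-submodule of `Hom*(X, Y)` whose components are those of a stable family. -/
def toSubmodule : Submodule R (φ.HomStar X Y) where
  carrier := {x | ∀ n, φ.component n x ∈ P.deg n}
  add_mem' := by
    intro x y hx hy n
    rw [_root_.map_add]
    exact add_mem (hx n) (hy n)
  zero_mem' := fun n => by
    rw [_root_.map_zero]
    exact zero_mem _
  smul_mem' := by
    intro r x hx
    induction r using DirectSum.Decomposition.inductionOn 𝒜 with
    | zero =>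
      intro n
      rw [zero_smul, _root_.map_zero]
      exact zero_mem _
    | @homogeneous m a =>
      intro n
      rw [φ.component_smul X Y a (n - m) n (by omega)]
      exact P.act_mem _ _ (hx _)
    | add a b ha hb =>
      intro n
      rw [add_smul, _root_.map_add]
      exact add_mem (ha n) (hb n)

lemma mem_toSubmodule {x : φ.HomStar X Y} : x ∈ P.toSubmodule ↔ ∀ n, φ.component n x ∈ P.deg n :=
  Iff.rfl

lemma ofDeg_mem_toSubmodule {n : ℤ} {f : φ.HomDeg X Y n} :
    φ.ofDeg n f ∈ P.toSubmodule ↔ f ∈ P.deg n := by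
  rw [mem_toSubmodule]
  refine ⟨fun h => by simpa only [component_ofDeg] using h n, fun h k => ?_⟩
  by_cases hk : n = k
  · subst hk
    rwa [component_ofDeg]
  · rw [φ.component_ofDeg_of_ne hk]
    exact zero_mem _

/-- If homogeneous elements of degree `d` spanning an ideal map `Q` into `P`, then so does every
homogeneous element of this ideal. -/
lemma act_mem_of_mem_span {d : ℕ} {G : Set R} (hG : G ⊆ 𝒜 d)
    (H : ∀ a : 𝒜 d, a.1 ∈ G → ∀ {n p : ℤ} (h : n + d = p), ∀ f ∈ Q.deg n, φ.act n p h a f ∈ P.deg p)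
    {m : ℕ} (a : 𝒜 m) (ha : a.1 ∈ Ideal.span G) {n p : ℤ} (h : n + m = p)
    {f : φ.HomDeg X Y n} (hf : f ∈ Q.deg n) : φ.act n p h a f ∈ P.deg p := by
  -- The elements of R carrying Q into P form an ideal, so checking the generators suffices.
  have h1 : Ideal.span G ≤ P.toSubmodule.colon (Q.toSubmodule : Set (φ.HomStar X Y)) := by
    refine Ideal.span_le.2 fun r hr => ?_
    refine Submodule.mem_colon.2 fun x hx k => ?_
    rw [φ.component_smul X Y (⟨r, hG hr⟩ : 𝒜 d) (k - d) k (by omega)]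
    exact H _ hr _ _ (hx _)
  have h2 := Submodule.mem_colon.1 (h1 ha) _ (Q.ofDeg_mem_toSubmodule.2 hf)
  rwa [φ.smul_ofDeg X Y a n p h, ofDeg_mem_toSubmodule] at h2

/-- The family which is zero below `n₀`, is `Q` up to `j`, and is `P` beyond `j`. -/
def glue (hPQ : ∀ n, P.deg n ≤ Q.deg n)
    (H : ∀ {m : ℕ}, 0 < m → ∀ (a : 𝒜 m) {n p : ℤ} (h : n + m = p), ∀ f ∈ Q.deg n,
      φ.act n p h a f ∈ P.deg p) (n₀ j : ℤ) : φ.StableFamily X Y where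
  deg n := if n < n₀ then ⊥ else if n ≤ j then Q.deg n else P.deg n
  act_mem := by
    intro m n p h a f hf
    by_cases hn : n < n₀
    · rw [if_pos hn, Submodule.mem_bot] at hf
      rw [hf, _root_.map_zero]
      exact zero_mem _
    rw [if_neg hn] at hf
    rw [if_neg (by omega)]
    -- Degree 0 elements stay on the same side of j. Elements of positive degree may cross it, but
    -- they land in P, which is contained in Q.
    rcases Nat.eq_zero_or_pos m with rfl | hm
    · obtain rfl : n = p := by simpa using h
      split_ifs at hf ⊢
      · exact Q.act_mem h a hf
      · exact P.act_mem h a hf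
    · have hf' : f ∈ Q.deg n := by
        split_ifs at hf
        · exact hf
        · exact hPQ _ hf
      have h1 := H hm a h f hf'
      split_ifs
      · exact hPQ _ h1
      · exact h1

/-- If `Hom^{≥ n₀}(X, Y)` is Noetherian and the elements of positive degree map `Q` into `P`,
then `P` and `Q` agree in large degrees. -/
lemma eventually_deg_eq {n₀ : ℤ} (hN : IsNoetherian R (φ.homGE X Y n₀))
    (hPQ : ∀ n, P.deg n ≤ Q.deg n)
    (H : ∀ {m : ℕ}, 0 < m → ∀ (a : 𝒜 m) {n p : ℤ} (h : n + m = p), ∀ f ∈ Q.deg n,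
      φ.act n p h a f ∈ P.deg p) : ∀ᶠ n : ℤ in atTop, P.deg n = Q.deg n := by
  -- An ascending chain: raising j by one replaces P by Q in one more degree.
  let c : ℕ →o Submodule R (φ.homGE X Y n₀) :=
    { toFun := fun j => (glue P Q hPQ H n₀ j).toSubmodule.comap (φ.homGE X Y n₀).subtype
      monotone' := by
        intro i j hij x hx n
        have h1 := hx n
        simp only [glue] at h1 ⊢
        by_cases h₁ : n < n₀
        · rwa [if_pos h₁] at h1 ⊢
        rw [if_neg h₁] at h1 ⊢
        by_cases h₂ : n ≤ i
        · rw [if_pos h₂] at h1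
          rwa [if_pos (by omega)]
        rw [if_neg h₂] at h1
        split_ifs
        · exact hPQ _ h1
        · exact h1 }
  obtain ⟨j₀, hj₀⟩ := monotone_stabilizes_iff_noetherian.2 hN c
  filter_upwards [eventually_gt_atTop (j₀ : ℤ), eventually_ge_atTop n₀, eventually_ge_atTop 0]
    with n h1 h2 h3
  refine le_antisymm (hPQ n) fun f hf => ?_
  have hmem : φ.ofDeg n f ∈ φ.homGE X Y n₀ := fun k hk =>
    φ.component_ofDeg_of_ne (by omega) f
  have h4 : (⟨_, hmem⟩ : φ.homGE X Y n₀) ∈ c n.toNat := by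
    refine (ofDeg_mem_toSubmodule _).2 ?_
    simp only [glue]
    rwa [if_neg (by omega), if_pos (by omega)]
  -- The chain is constant from j₀ on. In degree n > j₀ its member at n has component Q, while its
  -- member at j₀ has component P.
  rw [← hj₀ n.toNat (by omega)] at h4
  have h5 := (ofDeg_mem_toSubmodule _).1 h4
  simp only [glue] at h5
  rwa [if_neg (by omega), if_neg (by omega)] at h5

/-- The stable family `P + aQ`. -/
def supMap {d : ℕ} (a : 𝒜 d) : φ.StableFamily X Y where
  deg p := P.deg p ⊔ (Q.deg (p - d)).map (φ.actLinear a (p - d) p (by omega))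
  act_mem := by
    intro m n p h b f hf
    obtain ⟨g, hg, _, ⟨q, hq, rfl⟩, rfl⟩ := Submodule.mem_sup.1 hf
    rw [_root_.map_add]
    refine Submodule.add_mem_sup (P.act_mem h b hg)
      ⟨φ.act (n - d) (p - d) (by omega) b q, Q.act_mem _ _ hq, ?_⟩
    exact φ.act_comm a b _ _ _ _ q

lemma supMap_deg {d : ℕ} (a : 𝒜 d) {n p : ℤ} (h : n + d = p) :
    (supMap P Q a).deg p = P.deg p ⊔ (Q.deg n).map (φ.actLinear a n p h) := by
  obtain rfl : n = p - d := by omega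
  rfl

/-- The stable family of the elements of `Q` mapped into `P` by `a`. -/
def infComap {d : ℕ} (a : 𝒜 d) : φ.StableFamily X Y where
  deg n := Q.deg n ⊓ (P.deg (n + d)).comap (φ.actLinear a n (n + d) rfl)
  act_mem := by
    intro m n p h b f hf
    refine ⟨Q.act_mem h b hf.1, ?_⟩
    change φ.act p (p + d) rfl a (φ.act n p h b f) ∈ P.deg (p + d)
    rw [φ.act_comm a b h rfl rfl (by omega)]
    exact P.act_mem _ b hf.2

/-- The length of a component of a stable family, as an integer. -/
noncomputable def len (n : ℤ) : ℤ := ((Module.length (𝒜 0) (P.deg n)).toNat : ℤ)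

lemma len_nonneg (n : ℤ) : 0 ≤ P.len n := Int.natCast_nonneg _

lemma length_deg_ne_top (hfl : ∀ n : ℤ, φ.homLength X Y n < ⊤) (n : ℤ) :
    Module.length (𝒜 0) (P.deg n) ≠ ⊤ :=
  ((Module.length_le_of_injective _ (Submodule.subtype_injective _)).trans_lt (hfl n)).ne

lemma len_le_lam (hfl : ∀ n : ℤ, φ.homLength X Y n < ⊤) (n : ℤ) :
    P.len n ≤ (φ.lam X Y n : ℤ) :=
  Int.ofNat_le.2 (ENat.toNat_le_toNat
    (Module.length_le_of_injective _ (Submodule.subtype_injective _)) (hfl n).ne)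

lemma len_supMap_add_len_infComap (hfl : ∀ n : ℤ, φ.homLength X Y n < ⊤) {d : ℕ} (a : 𝒜 d)
    (n : ℤ) : (supMap P Q a).len (n + d) + (infComap P Q a).len n = P.len (n + d) + Q.len n := by
  have h := Submodule.length_sup_map_add_length_inf_comap (φ.actLinear a n (n + d) rfl)
    (P.deg (n + d)) (Q.deg n)
  rw [← supMap_deg] at h
  change _ + Module.length (𝒜 0) ((infComap P Q a).deg n) = _ at h
  have h' := congrArg ENat.toNat h
  rw [ENat.toNat_add (length_deg_ne_top _ hfl _) (length_deg_ne_top (infComap P Q a) hfl n),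
    ENat.toNat_add (length_deg_ne_top _ hfl _) (length_deg_ne_top _ hfl _)] at h'
  simp only [len]
  exact_mod_cast h'

/-- The Hilbert-Serre theorem for a subquotient `Q / P` of `Hom*(X, Y)`. -/
lemma exists_diffOp_iter_len_sub_len {d : ℕ}
    (hgen : Subring.closure ((𝒜 0 : Set R) ∪ (𝒜 d : Set R)) = ⊤) (h : φ.IsNoethFl X Y)
    {G : Finset R} (hG : (G : Set R) ⊆ 𝒜 d)
    (hGspan : Ideal.span (𝒜 d : Set R) = Ideal.span (G : Set R)) (S : Finset R)
    (P Q : φ.StableFamily X Y) (hPQ : ∀ n, P.deg n ≤ Q.deg n)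
    (H : ∀ a : 𝒜 d, a.1 ∈ G → a.1 ∉ S → ∀ {n p : ℤ} (h : n + d = p), ∀ f ∈ Q.deg n,
      φ.act n p h a f ∈ P.deg p) :
    ∃ N, (diffOp d)^[N] (fun n => Q.len n - P.len n) =ᶠ[atTop] 0 := by
  -- Induction on the set S of generators that may act nontrivially on Q / P.
  classical
  induction S using Finset.induction_on generalizing P Q with
  | empty =>
    obtain ⟨n₀, hN⟩ := h.eventually_noetherian
    refine ⟨0, ?_⟩
    filter_upwards [eventually_deg_eq P Q hN hPQ fun hm a n p h f hf =>
      act_mem_of_mem_span P Q hG (fun a ha => H a ha (Finset.notMem_empty _)) a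
        (hGspan ▸ GradedRing.mem_span_of_closure_eq_top 𝒜 hgen hm a.2) h hf] with n hn
    change Q.len n - P.len n = 0
    rw [len, len, hn, sub_self]
  | insert x S hx ih =>
    by_cases hxG : x ∈ G
    · let a : 𝒜 d := ⟨x, hG hxG⟩
      obtain ⟨N₁, h₁⟩ := ih (supMap P Q a) Q
        (fun n => sup_le (hPQ n) (Submodule.map_le_iff_le_comap.2 fun f hf => Q.act_mem _ _ hf))
        (fun b hb hbS n p h f hf => by
          rw [supMap_deg P Q a h]
          by_cases hbx : b.1 = x
          · obtain rfl : b = a := Subtype.ext hbx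
            exact Submodule.mem_sup_right ⟨f, hf, rfl⟩
          · exact Submodule.mem_sup_left (H b hb (by simp [hbx, hbS]) h f hf))
      obtain ⟨N₂, h₂⟩ := ih P (infComap P Q a)
        (fun n f hf => ⟨hPQ n hf, P.act_mem _ _ hf⟩)
        (fun b hb hbS n p h f hf => by
          by_cases hbx : b.1 = x
          · obtain rfl : b = a := Subtype.ext hbx
            subst h
            exact hf.2
          · exact H b hb (by simp [hbx, hbS]) h f hf.1)
      refine ⟨max N₁ N₂ + 1, ?_⟩
      have h₃ := diffOp_iter_eventually_zero_mono d (le_max_left N₁ N₂) h₁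
      have h₄ := diffOp_iter_eventually_zero_mono d (le_max_right N₁ N₂) h₂
      -- The difference of the Hilbert function of Q / P is the cokernel length in degree n + d
      -- minus the kernel length in degree n. This costs one extra application of Δ.
      have h₅ : diffOp d (fun n => Q.len n - P.len n) =
          (fun n => Q.len (n + d) - (supMap P Q a).len (n + d)) -
            fun n => (infComap P Q a).len n - P.len n := by
        ext n
        have := len_supMap_add_len_infComap P Q h.homLength_lt_top a n
        simp only [diffOp, Pi.sub_apply]
        omega
      rw [Function.iterate_succ_apply, h₅, diffOp_iter_sub,
        diffOp_iter_comp_add d _ (fun n => Q.len n - (supMap P Q a).len n)]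
      filter_upwards [h₄, (tendsto_add_atTop_int d).eventually h₃] with n h₆ h₇
      rw [Pi.sub_apply, h₆, h₇]
      simp
    · refine ih P Q hPQ fun b hb hbS => H b hb ?_
      rw [Finset.mem_insert, not_or]
      exact ⟨fun hbx => hxG (hbx ▸ hb), hbS⟩

/-- The length function of a stable family in an eventually Noetherian `Hom*(X, Y)` is killed
eventually by an iterate of the difference operator. -/
lemma exists_diffOp_iter_len [IsNoetherianRing R] {d : ℕ}
    (hgen : Subring.closure ((𝒜 0 : Set R) ∪ (𝒜 d : Set R)) = ⊤) (h : φ.IsNoethFl X Y) :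
    ∃ N, (diffOp d)^[N] P.len =ᶠ[atTop] 0 := by
  obtain ⟨G, hG, hGspan⟩ := GradedRing.exists_finset_span_eq 𝒜 d
  let B : φ.StableFamily X Y :=
    { deg := fun _ => ⊥
      act_mem := by
        intro m n p h a f hf
        rw [Submodule.mem_bot] at hf ⊢
        rw [hf, _root_.map_zero] }
  -- With S = G the condition on generators outside S is vacuous; the subquotient is P / 0.
  obtain ⟨N, hN⟩ := exists_diffOp_iter_len_sub_len hgen h hG hGspan G B P
    (fun n => bot_le) (fun a ha ha' => absurd ha ha')
  refine ⟨N, ?_⟩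
  have hB : ∀ n, B.len n = 0 := fun n => by
    simp [len, B]
  simpa only [hB, sub_zero] using hN

end StableFamily

/-! ### Hilbert polynomials -/

variable (X Y)

/-- `Hom*(X, Y)` as a stable family. -/
def topFamily : φ.StableFamily X Y where
  deg _ := ⊤
  act_mem _ _ _ _ := Submodule.mem_top

lemma topFamily_len (n : ℤ) : (φ.topFamily X Y).len n = (φ.lam X Y n : ℤ) :=
  congrArg (fun l : ℕ∞ => (l.toNat : ℤ)) Module.length_top

variable {X Y}

lemma exists_isHilbertPoly [IsNoetherianRing R] {d : ℕ} (hd : 0 < d)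
    (hgen : Subring.closure ((𝒜 0 : Set R) ∪ (𝒜 d : Set R)) = ⊤) (h : φ.IsNoethFl X Y) (i : ℕ) :
    ∃ g, φ.IsHilbertPoly X Y d i g := by
  obtain ⟨N, hN⟩ := (φ.topFamily X Y).exists_diffOp_iter_len hgen h
  obtain ⟨g, hg⟩ := exists_polynomial_of_diffOp_iter_eventually_zero hd hN i
  refine ⟨g, hg.mono fun n hn => ?_⟩
  rw [hn, topFamily_len]
  simp

lemma exists_polynomial_degree_lt_of_cx_le [IsNoetherianRing R] {d : ℕ} (hd : 0 < d)
    (hgen : Subring.closure ((𝒜 0 : Set R) ∪ (𝒜 d : Set R)) = ⊤) (h : φ.IsNoethFl X Y) {s : ℕ}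
    (hs : φ.cx X Y d ≤ s) {i : ℕ} (hi : i < d) :
    ∃ g : Polynomial ℚ, g.degree < s ∧
      ∀ᶠ n : ℤ in atTop, g.eval (n : ℚ) = (((φ.lam X Y (d * n + i) : ℕ) : ℤ) : ℚ) := by
  have hex := φ.exists_isHilbertPoly hd hgen h i
  refine ⟨φ.hilbertPoly X Y d i, ?_, ?_⟩
  · have h1 := Finset.sup_le_iff.1 hs i (Finset.mem_range.2 hi)
    by_cases h0 : φ.hilbertPoly X Y d i = 0
    · rw [h0, Polynomial.degree_zero]
      exact WithBot.bot_lt_coe _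
    · rw [if_neg h0] at h1
      exact (Polynomial.natDegree_lt_iff_degree_lt h0).1 (by omega)
  · rw [hilbertPoly, dif_pos hex]
    refine hex.choose_spec.mono fun n hn => ?_
    rw [hn]
    simp

lemma diffOp_iter_lam_eventually_zero [IsNoetherianRing R] {d : ℕ} (hd : 0 < d)
    (hgen : Subring.closure ((𝒜 0 : Set R) ∪ (𝒜 d : Set R)) = ⊤) (h : φ.IsNoethFl X Y) {s : ℕ}
    (hs : φ.cx X Y d ≤ s) : (diffOp d)^[s] (fun n => (φ.lam X Y n : ℤ)) =ᶠ[atTop] 0 :=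
  diffOp_iter_eventually_zero_of_polynomial hd fun _ hi =>
    φ.exists_polynomial_degree_lt_of_cx_le hd hgen h hs hi

/-- Hilbert-Serre gives vanishing at some uncontrolled order N; the bound by λ then brings the order
down to s. It is applied to the kernel family of the triangle. -/
lemma StableFamily.diffOp_iter_len_eventually_zero [IsNoetherianRing R] {φ : CentralAction 𝒜 C}
    (P : φ.StableFamily X Y) {d : ℕ} (hd : 0 < d)
    (hgen : Subring.closure ((𝒜 0 : Set R) ∪ (𝒜 d : Set R)) = ⊤) (h : φ.IsNoethFl X Y) {s : ℕ}
    (hs : φ.cx X Y d ≤ s) : (diffOp d)^[s] P.len =ᶠ[atTop] 0 := by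
  obtain ⟨N, hN⟩ := P.exists_diffOp_iter_len hgen h
  exact diffOp_iter_eventually_zero_of_le hd P.len_nonneg (P.len_le_lam h.homLength_lt_top) hN
    fun _ hi => φ.exists_polynomial_degree_lt_of_cx_le hd hgen h hs hi

end CentralAction

/-- Length count for an exact sequence 0 → k → l₁ → l₂ → l₃ → k' → 0, where r and r' are the lengths
of the images in l₂ and l₃. Finiteness makes `toNat` additive. -/
lemma ENat.toNat_add_toNat_of_exact {k k' r r' l₁ l₂ l₃ : ℕ∞} (e₁ : k + r = l₁)
    (e₂ : r + r' = l₂) (e₃ : r' + k' = l₃) (t₁ : l₁ < ⊤) (t₂ : l₂ < ⊤) (t₃ : l₃ < ⊤) :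
    (l₁.toNat : ℤ) + l₃.toNat = l₂.toNat + ((k.toNat : ℤ) + k'.toNat) := by
  subst e₁ e₂ e₃
  rw [ENat.add_lt_top] at t₁ t₂ t₃
  rw [ENat.toNat_add t₁.1.ne t₁.2.ne, ENat.toNat_add t₂.1.ne t₂.2.ne,
    ENat.toNat_add t₃.1.ne t₃.2.ne]
  push_cast
  ring

namespace CentralAction

variable {R : Type w} [CommRing R] {𝒜 : ℕ → AddSubgroup R} [GradedRing 𝒜]
  {C : Type u} [Category.{v} C] [HasShift C ℤ] [Preadditive C]
  [∀ n : ℤ, (shiftFunctor C n).Additive] (φ : CentralAction 𝒜 C) {X Y : C}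

/-! ### The long exact sequence of a triangle -/

/-- In degree 0, naturality alone suffices. Hence g may change the shift, as the connecting map
does. -/
lemma actMor_zero_comp {Z : C} {n m : ℤ} (g : Y⟦n⟧ ⟶ Z⟦m⟧) (c : 𝒜 0) (f : X ⟶ Y⟦n⟧) :
    φ.actMor n n (by simp) c f ≫ g = φ.actMor m m (by simp) c (f ≫ g) := by
  have h₁ := (φ.toHom 0 c).1.naturality g
  have h₂ : ∀ (W : C) (k : ℤ), (shiftFunctorAdd' C k ((0 : ℕ) : ℤ) k (add_zero k)).inv.app W =
      (shiftFunctorZero C ℤ).hom.app (W⟦k⟧) := fun W k =>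
    shiftFunctorAdd'_add_zero_inv_app (C := C) k W
  have h₃ := (shiftFunctorZero C ℤ).hom.naturality g
  simp only [Functor.id_map, Functor.id_obj] at h₁ h₃
  simp only [actMor, Category.assoc]
  rw [h₂, h₂, reassoc_of% h₁]
  exact congrArg (fun t => f ≫ (φ.toHom 0 c).1.app (Y⟦n⟧) ≫ t) h₃.symm

lemma actMor_comp {Z : C} (g : Y ⟶ Z) {m : ℕ} {n p : ℤ} (h : n + m = p) (a : 𝒜 m)
    (f : X ⟶ Y⟦n⟧) : φ.actMor n p h a f ≫ g⟦p⟧' = φ.actMor n p h a (f ≫ g⟦n⟧') := by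
  have h₁ := (φ.toHom m a).1.naturality (g⟦n⟧')
  have h₂ := (shiftFunctorAdd' C n m p h).inv.naturality g
  simp only [Functor.id_map, Functor.id_obj, Functor.comp_map] at h₁ h₂
  simp only [actMor, Category.assoc]
  rw [reassoc_of% h₁, h₂]

/-- Composition with a morphism, as a linear map between components of `Hom*(X, -)`. -/
def compLinear {Z : C} {n m : ℤ} (g : Y⟦n⟧ ⟶ Z⟦m⟧) : φ.HomDeg X Y n →ₗ[𝒜 0] φ.HomDeg X Z m where
  toFun f := (f : X ⟶ Y⟦n⟧) ≫ g
  map_add' f f' := Preadditive.add_comp X _ _ (f : X ⟶ Y⟦n⟧) f' g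
  map_smul' c f := φ.actMor_zero_comp g c f

lemma act_comp {Z : C} (g : Y ⟶ Z) {m : ℕ} {n p : ℤ} (h : n + m = p) (a : 𝒜 m)
    (f : φ.HomDeg X Y n) :
    φ.compLinear (g⟦p⟧') (φ.act n p h a f) = φ.act n p h a (φ.compLinear (g⟦n⟧') f) :=
  φ.actMor_comp g h a f

variable (X) in
/-- The kernel of the map `Hom*(X, Y) ⟶ Hom*(X, Z)` induced by a morphism. -/
def kerFamily {Z : C} (g : Y ⟶ Z) : φ.StableFamily X Y where
  deg n := (φ.compLinear (g⟦n⟧')).ker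
  act_mem := by
    intro m n p h a f hf
    rw [LinearMap.mem_ker] at hf ⊢
    rw [φ.act_comp, hf, _root_.map_zero]

section Triangle

variable [HasZeroObject C] [Pretriangulated C] {T : Pretriangulated.Triangle C}
  (hT : T ∈ Pretriangulated.distinguishedTriangles)

include hT

lemma range_compLinear_mor₁ (n : ℤ) :
    (φ.compLinear (X := X) (T.mor₁⟦n⟧')).range = (φ.compLinear (T.mor₂⟦n⟧')).ker := by
  have h := (preadditiveCoyoneda.obj (Opposite.op X)).homologySequence_exact₂ T hT n
  rw [ShortComplex.ab_exact_iff_function_exact] at h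
  ext f
  exact (h f).symm

/-- There is a connecting map `Hom(X, Σⁿ Y₃) ⟶ Hom(X, Σⁿ⁺¹ Y₁)`, linear over `R⁰`, with exactness at
both ends. -/
lemma exists_connecting (n : ℤ) :
    ∃ δ : φ.HomDeg X T.obj₃ n →ₗ[𝒜 0] φ.HomDeg X T.obj₁ (n + 1),
      (φ.compLinear (T.mor₂⟦n⟧')).range = δ.ker ∧
      δ.range = (φ.compLinear (T.mor₁⟦n + 1⟧')).ker := by
  refine ⟨φ.compLinear (T.mor₃⟦n⟧' ≫ (shiftFunctorAdd' C 1 n (n + 1) (by lia)).inv.app _), ?_, ?_⟩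
  · have h := (preadditiveCoyoneda.obj (Opposite.op X)).homologySequence_exact₃ T hT n _ rfl
    rw [ShortComplex.ab_exact_iff_function_exact] at h
    ext f
    have hf := Pretriangulated.preadditiveCoyoneda_homologySequenceδ_apply T n (n + 1) rfl
      (A := Opposite.op X) f
    exact (h f).symm.trans ⟨fun e => hf.symm.trans e, fun e => hf.trans e⟩
  · have h := (preadditiveCoyoneda.obj (Opposite.op X)).homologySequence_exact₁ T hT n _ rfl
    rw [ShortComplex.ab_exact_iff_function_exact] at h
    ext f
    refine Iff.trans (exists_congr fun g => ?_) (h f).symm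
    have hg := Pretriangulated.preadditiveCoyoneda_homologySequenceδ_apply T n (n + 1) rfl
      (A := Opposite.op X) g
    exact ⟨fun e => hg.trans e, fun e => hg.symm.trans e⟩

/-- The long exact sequence is cut at the kernels of `T.mor₁` in degrees n and n + 1; the latter is
the image of the connecting map. -/
lemma lam_add_lam (h₁ : φ.IsNoethFl X T.obj₁) (h₂ : φ.IsNoethFl X T.obj₂)
    (h₃ : φ.IsNoethFl X T.obj₃) (n : ℤ) :
    (φ.lam X T.obj₁ n : ℤ) + φ.lam X T.obj₃ n = φ.lam X T.obj₂ n +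
      ((φ.kerFamily X T.mor₁).len n + (φ.kerFamily X T.mor₁).len (n + 1)) := by
  obtain ⟨δ, hδ₁, hδ₂⟩ := φ.exists_connecting (X := X) hT n
  have e₁ := Module.length_ker_add_length_range (φ.compLinear (X := X) (T.mor₁⟦n⟧'))
  have e₂ := Module.length_ker_add_length_range (φ.compLinear (X := X) (T.mor₂⟦n⟧'))
  have e₃ := Module.length_ker_add_length_range δ
  rw [← φ.range_compLinear_mor₁ hT] at e₂
  rw [← hδ₁, hδ₂] at e₃
  exact ENat.toNat_add_toNat_of_exact e₁ e₂ e₃ (h₁.homLength_lt_top n) (h₂.homLength_lt_top n)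
    (h₃.homLength_lt_top n)

end Triangle

/-! ### Herbrand differences and multiplicities -/

section Herbrand

variable (X Y)

/-- The two windows of d consecutive terms differ only in their end terms, at n and n + d, which
carry the same sign because d is even. -/
lemma herbrand_sub_herbrand_add_one {d : ℕ} (hd : Even d) (n : ℤ) :
    φ.herbrand X Y d (n + 1) - φ.herbrand X Y d n =
      (n.negOnePow : ℤ) * diffOp d (fun n => (φ.lam X Y n : ℤ)) n := by
  have h1 : φ.herbrand X Y d (n + 1) = ∑ i ∈ Finset.range d,
      ((n + ((i + 1 : ℕ) : ℤ)).negOnePow : ℤ) * (φ.lam X Y (n + ((i + 1 : ℕ) : ℤ)) : ℤ) := by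
    refine Finset.sum_congr rfl fun i _ => ?_
    rw [show n + 1 + (i : ℤ) = n + ((i + 1 : ℕ) : ℤ) by push_cast; ring]
  have h2 := Finset.sum_range_succ (fun i : ℕ =>
    ((n + i).negOnePow : ℤ) * (φ.lam X Y (n + i) : ℤ)) d
  rw [Finset.sum_range_succ'] at h2
  have h3 : (n + d).negOnePow = n.negOnePow := by
    rw [Int.negOnePow_add, Int.negOnePow_even (d : ℤ) (by exact_mod_cast hd), mul_one]
  rw [h1, herbrand, diffOp, mul_sub, ← h3]
  simp only [Nat.cast_zero, add_zero] at h2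
  rw [h3] at h2 ⊢
  linarith

end Herbrand

end CentralAction

/-- For even d the sign (-1)ⁿ is d-periodic, so Δ treats it as a constant. -/
lemma diffOp_iter_negOnePow_mul {d : ℕ} (hd : Even d) (N : ℕ) (f : ℤ → ℤ) (n : ℤ) :
    (diffOp d)^[N] (fun n => (n.negOnePow : ℤ) * f n) n =
      (n.negOnePow : ℤ) * (diffOp d)^[N] f n := by
  induction N generalizing f n with
  | zero => rfl
  | succ N ih =>
    rw [Function.iterate_succ_apply, Function.iterate_succ_apply, ← ih]
    refine congrFun (congrArg _ (funext fun m => ?_)) n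
    rw [diffOp, diffOp, Int.negOnePow_add, Int.negOnePow_even (d : ℤ) (by exact_mod_cast hd),
      mul_one, mul_sub]

namespace CentralAction

variable {R : Type w} [CommRing R] {𝒜 : ℕ → AddSubgroup R} [GradedRing 𝒜]
  {C : Type u} [Category.{v} C] [HasShift C ℤ] [Preadditive C]
  [∀ n : ℤ, (shiftFunctor C n).Additive] (φ : CentralAction 𝒜 C) {X Y : C}

/-- The iterated difference of the Herbrand function is eventually constant, so that the
multiplicity is its eventual value. -/
lemma eventually_diffOp_iter_herbrand_eq_mult [IsNoetherianRing R] {d : ℕ} (hd : 0 < d)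
    (hd_even : Even d) (hgen : Subring.closure ((𝒜 0 : Set R) ∪ (𝒜 d : Set R)) = ⊤)
    (h : φ.IsNoethFl X Y) {s : ℕ} (hs : φ.cx X Y d ≤ s + 1) :
    ∀ᶠ n : ℤ in atTop, (diffOp d)^[s] (φ.herbrand X Y d) n = φ.mult X Y d (s + 1) := by
  obtain ⟨c, hc⟩ := eventually_const_of_eventually_add_one_eq
    (f := (diffOp d)^[s] (φ.herbrand X Y d)) (by
      -- The increment of Δˢh from n to n + 1 is (-1)ⁿ Δˢ⁺¹λ(n), which vanishes for large n.
      filter_upwards [φ.diffOp_iter_lam_eventually_zero hd hgen h hs] with n hn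
      have h1 := congrFun (diffOp_iter_comp_add d s (φ.herbrand X Y d) 1) n
      have h2 : (fun n => φ.herbrand X Y d (n + 1)) - φ.herbrand X Y d =
          fun n => (n.negOnePow : ℤ) * diffOp d (fun n => (φ.lam X Y n : ℤ)) n :=
        funext fun n => φ.herbrand_sub_herbrand_add_one X Y hd_even n
      have h3 := congrFun (diffOp_iter_sub d s (fun n => φ.herbrand X Y d (n + 1))
        (φ.herbrand X Y d)) n
      rw [h2, diffOp_iter_negOnePow_mul hd_even, ← Function.iterate_succ_apply, hn, Pi.sub_apply,
        h1, Pi.zero_apply, mul_zero] at h3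
      exact (sub_eq_zero.1 h3.symm))
  rw [mult, eventualValue_eq hc]
  exact hc

/-- If the complexity is zero, then the lengths vanish in large degrees. -/
lemma eventually_lam_eq_zero_of_cx_eq_zero [IsNoetherianRing R] {d : ℕ} (hd : 0 < d)
    (hgen : Subring.closure ((𝒜 0 : Set R) ∪ (𝒜 d : Set R)) = ⊤)
    (h : φ.IsNoethFl X Y) (hs : φ.cx X Y d ≤ 0) : ∀ᶠ n : ℤ in atTop, φ.lam X Y n = 0 := by
  filter_upwards [φ.diffOp_iter_lam_eventually_zero hd hgen h hs] with n hn
  exact Int.natCast_eq_zero.1 hn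

end CentralAction

/-! ### Alternating sums of finitely supported functions -/

lemma Int.finite_support_of_eventually {f : ℤ → ℤ} (h₁ : ∀ᶠ n in atTop, f n = 0)
    (h₂ : ∀ᶠ n in atBot, f n = 0) : f.support.Finite := by
  obtain ⟨a, ha⟩ := eventually_atTop.1 h₁
  obtain ⟨b, hb⟩ := eventually_atBot.1 h₂
  refine (Set.finite_Icc b a).subset fun n hn => ⟨?_, ?_⟩
  · by_contra hlt
    exact hn (hb n (by omega))
  · by_contra hlt
    exact hn (ha n (by omega))

/-- Shifting the index by one reverses the sign. Finite support is needed to split the sum, as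
`finsum` is 0 by default on infinite supports. -/
lemma finsum_negOnePow_mul_add_eq_zero {k : ℤ → ℤ} (hk : k.support.Finite) :
    ∑ᶠ n : ℤ, (n.negOnePow : ℤ) * (k n + k (n + 1)) = 0 := by
  have h1 : (Function.support fun n : ℤ => (n.negOnePow : ℤ) * k n).Finite :=
    hk.subset fun n hn => right_ne_zero_of_mul hn
  have h2 : (Function.support fun n : ℤ => ((n + 1).negOnePow : ℤ) * k (n + 1)).Finite :=
    h1.preimage (add_left_injective (1 : ℤ)).injOn
  have h3 : ∑ᶠ n : ℤ, ((n + 1).negOnePow : ℤ) * k (n + 1) = ∑ᶠ n : ℤ, (n.negOnePow : ℤ) * k n :=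
    finsum_comp_equiv (Equiv.addRight (1 : ℤ)) (f := fun n : ℤ => (n.negOnePow : ℤ) * k n)
  rw [← sub_eq_zero.2 h3.symm, ← finsum_sub_distrib h1 h2]
  refine finsum_congr fun n => ?_
  rw [Int.negOnePow_succ, Units.val_neg]
  ring

/-! ### Additivity of the multiplicity -/

theorem mainTheorem4
    {R : Type w} [CommRing R] [IsNoetherianRing R]
    (𝒜 : ℕ → AddSubgroup R) [GradedRing 𝒜]
    (d : ℕ) (hd : 2 ≤ d) (hd_even : Even d)
    (hgen : Subring.closure ((𝒜 0 : Set R) ∪ (𝒜 d : Set R)) = ⊤)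
    (hR₀ : (∃ k : Subring (𝒜 0), IsField k ∧ Infinite k) ∨
      (∃ _ : IsLocalRing (𝒜 0), Infinite (IsLocalRing.ResidueField (𝒜 0))))
    {C : Type u} [Category.{v} C] [HasZeroObject C] [HasShift C ℤ] [Preadditive C]
    [∀ n : ℤ, (shiftFunctor C n).Additive] [Pretriangulated C] [IsTriangulated C]
    (φ : CentralAction 𝒜 C) (X : C)
    (T : Pretriangulated.Triangle C) (hT : T ∈ Pretriangulated.distinguishedTriangles)
    (h₁ : φ.IsNoethFl X T.obj₁) (h₂ : φ.IsNoethFl X T.obj₂) (h₃ : φ.IsNoethFl X T.obj₃)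
    (s : ℕ) (hs₁ : φ.cx X T.obj₁ d ≤ s) (hs₂ : φ.cx X T.obj₂ d ≤ s) (hs₃ : φ.cx X T.obj₃ d ≤ s)
    (hs : 1 ≤ s ∨ (s = 0 ∧ ∀ Y ∈ ({T.obj₁, T.obj₂, T.obj₃} : Set C),
      ∀ᶠ n : ℤ in atBot, φ.lam X Y n = 0)) :
    φ.mult X T.obj₂ d s = φ.mult X T.obj₁ d s + φ.mult X T.obj₃ d s := by
  have hd₀ : 0 < d := by omega
  set K := φ.kerFamily X T.mor₁
  have hlam := φ.lam_add_lam hT h₁ h₂ h₃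
  rcases s with _ | s
  · obtain ⟨-, hbot⟩ := hs.resolve_left (by omega)
    have fin : ∀ Y ∈ ({T.obj₁, T.obj₂, T.obj₃} : Set C), φ.IsNoethFl X Y → φ.cx X Y d ≤ 0 →
        (Function.support fun n => (φ.lam X Y n : ℤ)).Finite := fun Y hY h hcx =>
      Int.finite_support_of_eventually
        ((φ.eventually_lam_eq_zero_of_cx_eq_zero hd₀ hgen h hcx).mono fun n hn => by simp [hn])
        ((hbot Y hY).mono fun n hn => by simp [hn])
    have f₁ := fin _ (by simp) h₁ hs₁
    have f₂ := fin _ (by simp) h₂ hs₂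
    have f₃ := fin _ (by simp) h₃ hs₃
    have fK : K.len.support.Finite := f₁.subset fun n hn hn' => hn (le_antisymm
      ((K.len_le_lam h₁.homLength_lt_top n).trans hn'.le) (K.len_nonneg n))
    have fin' : ∀ {l : ℤ → ℤ}, l.support.Finite →
        (Function.support fun n : ℤ => (n.negOnePow : ℤ) * l n).Finite := fun hl =>
      hl.subset fun n hn => right_ne_zero_of_mul hn
    have fK' : (Function.support fun n : ℤ => K.len (n + 1)).Finite :=
      fK.preimage (add_left_injective (1 : ℤ)).injOn
    have fK'' : (Function.support fun n : ℤ => K.len n + K.len (n + 1)).Finite :=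
      (fK.union fK').subset (Function.support_add _ _)
    simp only [CentralAction.mult]
    -- The vanishing alternating sum of k(n) + k(n+1) is added to the Y₂ side, so that the identity
    -- holds term by term.
    rw [← finsum_add_distrib (fin' f₁) (fin' f₃),
      ← add_zero (∑ᶠ n : ℤ, (n.negOnePow : ℤ) * (φ.lam X T.obj₂ n : ℤ)),
      ← finsum_negOnePow_mul_add_eq_zero fK, ← finsum_add_distrib (fin' f₂) (fin' fK'')]
    refine finsum_congr fun n => ?_
    linear_combination -(n.negOnePow : ℤ) * hlam n
  -- From here on `s + 1` is the order of the multiplicity, so Δˢ is applied to h and Δˢ⁺¹ kills k.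
  · have hK := K.diffOp_iter_len_eventually_zero hd₀ hgen h₁ hs₁
    have hh : φ.herbrand X T.obj₁ d + φ.herbrand X T.obj₃ d - φ.herbrand X T.obj₂ d =
        fun n => (n.negOnePow : ℤ) * -diffOp d K.len n := by
      ext n
      -- Telescoping: (-1)ⁿ(k(n) + k(n+1)) = (-1)ⁿk(n) - (-1)ⁿ⁺¹k(n+1).
      have htel : ∀ j : ℕ, ∑ i ∈ Finset.range j, ((n + i).negOnePow : ℤ) *
          (K.len (n + i) + K.len (n + i + 1)) =
          (n.negOnePow : ℤ) * K.len n - ((n + j).negOnePow : ℤ) * K.len (n + j) := by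
        intro j
        induction j with
        | zero => simp
        | succ j ih =>
          rw [Finset.sum_range_succ, ih]
          push_cast
          rw [← add_assoc, Int.negOnePow_succ, Units.val_neg]
          ring
      have h3 : (n + d).negOnePow = n.negOnePow := by
        rw [Int.negOnePow_add, Int.negOnePow_even (d : ℤ) (by exact_mod_cast hd_even), mul_one]
      have h4 := htel d
      rw [h3] at h4
      rw [diffOp, neg_sub, mul_sub, ← h4]
      simp only [Pi.sub_apply, Pi.add_apply, CentralAction.herbrand]
      rw [← Finset.sum_add_distrib, ← Finset.sum_sub_distrib]
      refine Finset.sum_congr rfl fun i _ => ?_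
      linear_combination ((n + i).negOnePow : ℤ) * hlam (n + i)
    have hz : (diffOp d)^[s] (φ.herbrand X T.obj₁ d + φ.herbrand X T.obj₃ d -
        φ.herbrand X T.obj₂ d) =ᶠ[atTop] 0 := by
      filter_upwards [hK] with n hn
      rw [hh, diffOp_iter_negOnePow_mul hd_even]
      change _ * (diffOp d)^[s] (-diffOp d K.len) n = 0
      rw [diffOp_iter_neg, Pi.neg_apply, ← Function.iterate_succ_apply, hn]
      simp
    -- One degree n, large enough for all three eventual values and for the vanishing of the defect,
    -- decides the equality.
    obtain ⟨n, e₁, e₂, e₃, e⟩ :=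
      ((φ.eventually_diffOp_iter_herbrand_eq_mult hd₀ hd_even hgen h₁ hs₁).and
      ((φ.eventually_diffOp_iter_herbrand_eq_mult hd₀ hd_even hgen h₂ hs₂).and
      ((φ.eventually_diffOp_iter_herbrand_eq_mult hd₀ hd_even hgen h₃ hs₃).and hz))).exists
    rw [diffOp_iter_sub, diffOp_iter_add, Pi.sub_apply, Pi.add_apply, e₁, e₂, e₃,
      Pi.zero_apply] at e
    omega
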